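/- **Conventions.** An orthomodular lattice (OML) is a lattice with $0,1$ and an order-reversing involution $'$ such that $a\cup a'=1$, $a\cap a'=0$, and $a\le b\Rightarrow a\cup(a'\cap b)=b$. In an OML put $a\to_1 b=a'\cup(a\cap b)$, $a\to_2 b=b'\to_1 a'$, $a\to_3 b=((a'\cap b)\cup(a'\cap b'))\cup(a\cap(a'\cup b))$, $a\to_4 b=b'\to_3 a'$, $a\to_5 b=((a\cap b)\cup(a'\cap b))\cup(a'\cap b')$, and $a\cup_i b=a'\to_i b$, $a\cap_i b=(a\to_i b')'$ for $i=1,\dots,5$; further $\cup_0=\cup$, $\cap_0=\cap$. A two-variable $\mathrm{QA}_{[0-5]}$ polynomial is a formal expression in $a,b,0,1,{}',\Cup,\Cap$. Two polynomials are equivalent if, for each $i=0,\dots,5$, substituting $\cup_i,\cap_i$ for $\Cup,\Cap$ in both of them gives an identity that holds in all OMLs. Let MO2 be the OML $\{0,x,y,y',x',1\}$ with four pairwise incomparable elements $x,y,y',x'$, and let $F(a,b)$ be the free OML on two generators. The Boolean part of $z\in F(a,b)$ is the Boolean function of $a,b$ that $z$ induces on $\{0,1\}$; the MO2 part of $z$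 is its image under the homomorphism $F(a,b)\to\mathrm{MO2}$ with $a\mapsto x$, $b\mapsto y$. Boolean functions are numbered $0,\dots,15$ in the order $0,\ a\cap b,\ a\cap b',\ a'\cap b,\ a'\cap b',\ a,\ b,\ (a\cap b)\cup(a'\cap b'),\ (a\cap b')\cup(a'\cap b),\ b',\ a',\ a\cup b,\ a\cup b',\ a'\cup b,\ a'\cup b',\ 1,$ and the elements of MO2 are numbered $0,\dots,5$ in the order $0,a,b,b',a',1$ (with $a=x$, $b=y$). For $1\le n\le 96$ put $n_{\rm B}=(n-1)\bmod 16$, $n_{\rm M}=\lfloor (n-1)/16\rfloor$, so that $n=16n_{\rm M}+n_{\rm B}+1$. The $n$-th Beran expression $n_{a,b}$ is the join of those of $a\cap b$, $a\cap b'$, $a'\cap b$, $a'\cap b'$ that lie below the Boolean function number $n_{\rm B}$, joined with $m\cap(a\cup b)\cap(a\cup b')\cap(a'\cup b)\cap(a'\cup b')$, where $m$ is the entry number $n_{\rm M}$ of the list $0,a,b,b',a',1$. A polynomial has septuple $\langle n_{\rm B},n_{{\rm M}_0},\dots,n_{{\rm M}_5}\rangle\in\{0,\dots,15\}\times\{0,\dots,5\}^6$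 if for each $i=0,\dots,5$ the element of $F(a,b)$ obtained from it by substituting $\cup_i,\cap_i$ has Boolean part number $n_{\rm B}$ and MO2 part number $n_{{\rm M}_i}$. **Statement.** 1. The map sending an element of $F(a,b)$ to the pair of its Boolean part and its MO2 part is a bijection from $F(a,b)$ onto the product of the set of the 16 Boolean functions with MO2. $F(a,b)$ has exactly 96 elements, and $n\mapsto n_{a,b}$ is a bijection from $\{1,\dots,96\}$ onto $F(a,b)$; the parts of $n_{a,b}$ have the numbers $n_{\rm B}$ and $n_{\rm M}$. 2. Every polynomial has exactly one septuple (in particular its Boolean part is the same for all $i$), two polynomials are equivalent if and only if their septuples are equal, and there are exactly $2^4\cdot 6^6=746496$ equivalence classes. 3. For $n=0,\dots,15$ the polynomial $B_n$ has septuple $\langle n,5,5,5,5,5,5\rangle$, and for $i=0,\dots,5$ and $n=0,\dots,4$ the polynomial $M_{i,n}$ has the septuple $\langle 15,5,5,5,5,5,5\rangle$ with the component $n_{{\rm M}_i}$ replaced by $n$, where - $B_{0}=((a\Cap b)\Cap (b\Cap a'))\Cup (((a'\Cup b)\Cap (b\Cup a))\Cap ((a\Cap b)'\Cap (b'\Cup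 a)))$ - $B_{1}=(a\Cap b)\Cup (((a'\Cup b)\Cap (b\Cup a))\Cap ((b\Cup a)\Cap (a\Cup b')))$ - $B_{2}=(a\Cap b')\Cup (((a\Cap b)'\Cap (b\Cup a))\Cap ((b'\Cup a)\Cap (a\Cup b)))$ - $B_{3}=(b\Cap a')\Cup (((b\Cap a)'\Cap (a\Cup b))\Cap ((a'\Cup b)\Cap (b\Cup a)))$ - $B_{4}=((a\Cup b)\Cap (((a'\Cap b)\Cap (b\Cup a))\Cup ((b\Cap a)\Cup (a\Cap b'))))'$ - $B_{5}=a\Cup ((a\Cap b)\Cup (a'\Cap ((b\Cup a)\Cap (a\Cup b'))))$ - $B_{6}=b\Cup ((a\Cap b)\Cup (a'\Cap ((b\Cup a)\Cap (a\Cup b'))))$ - $B_{7}=(a\Cap b)\Cup ((a\Cup b)'\Cup ((a\Cup b')\Cap (a'\Cup b)))$ - $B_{8}=(a\Cap b')\Cup ((a\Cap (b\Cap a))'\Cap ((b\Cup a)\Cup b))$ - $B_{9}=b'\Cup ((a\Cup b)'\Cup (a\Cap ((b\Cap a)'\Cap (a\Cup b))))$ - $B_{10}=a'\Cup ((a\Cup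 b)'\Cup (((a\Cup b)\Cap (b\Cap a)')\Cap b))$ - $B_{11}=a\Cup (b\Cup (b'\Cap (a\Cup (a\Cap b'))))$ - $B_{12}=a\Cup (b'\Cup (b\Cap (a\Cup (a\Cap b))))$ - $B_{13}=b\Cup (a'\Cup (a\Cap (b\Cup (b\Cap a))))$ - $B_{14}=(a\Cap (b'\Cap a))\Cup (a\Cap (b\Cap a))'$ - $B_{15}=1$ - $M_{0,0}=(a\Cap b)\Cup ((a\Cap b')\Cup (a'\Cap ((b\Cup a)'\Cup b)))$ - $M_{0,1}=a\Cup ((a'\Cap b)\Cup (b\Cup a)')$ - $M_{0,2}=b\Cup ((b'\Cap a)\Cup (a\Cup b)')$ - $M_{0,3}=b'\Cup ((b\Cap a)\Cup (a'\Cap b))$ - $M_{0,4}=a'\Cup ((a\Cap b)\Cup (b'\Cap a))$ - $M_{1,0}=(a\Cap (a'\Cup b))\Cup ((a\Cup (b\Cup a'))\Cap ((a\Cap b)'\Cup b))$ - $M_{1,1}=a\Cup (a\Cup ((b\Cup a)\Cup a'))$ - $M_{1,2}=b\Cup (a\Cup (b\Cap (b\Cup a))')$ - $M_{1,3}=b'\Cup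 (a\Cup ((b\Cap a)\Cup b))$ - $M_{1,4}=a'\Cup (b\Cup ((a\Cap b)\Cup a))$ - $M_{2,0}=((a\Cup b)\Cap b')\Cup ((a\Cup (a'\Cup b))\Cap ((b\Cup a)\Cup b'))$ - $M_{2,1}=a\Cup (b\Cup (b'\Cup (b\Cup a)))$ - $M_{2,2}=a\Cup (a'\Cup ((a\Cup b)\Cap b))$ - $M_{2,3}=a\Cup (a\Cap ((a\Cup b)\Cap b))'$ - $M_{2,4}=b\Cup (b\Cap ((b\Cup a)\Cap a))'$ - $M_{3,0}=(a\Cap (a\Cup (b\Cup a)))\Cup (a\Cup (a\Cap (b\Cup a)))'$ - $M_{3,1}=a\Cup (a'\Cup (b\Cup a))$ - $M_{3,2}=b\Cup (b'\Cup (a\Cup b))$ - $M_{3,3}=b\Cup (a\Cup (a\Cup b)')$ - $M_{3,4}=a\Cup (b\Cup (b\Cup a)')$ - $M_{4,0}=(a\Cap ((a\Cup b)\Cup a))\Cup (a\Cup ((a\Cup b)\Cap a))'$ - $M_{4,1}=a\Cup ((a\Cup b)\Cup a')$ - $M_{4,2}=b\Cup ((b\Cup a)\Cup b')$ - $M_{4,3}=a\Cup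 ((a\Cup b)'\Cup b)$ - $M_{4,4}=b\Cup ((b\Cup a)'\Cup a)$ - $M_{5,0}=(a\Cup b)\Cup (a\Cap b)'$ - $M_{5,1}=a\Cup (a\Cup (b\Cup (b\Cap a)'))$ - $M_{5,2}=b\Cup (a\Cup ((a\Cap b)'\Cup b))$ - $M_{5,3}=b'\Cup (b\Cup (a\Cup (a\Cup b)))$ - $M_{5,4}=a'\Cup (a\Cup (b\Cup (b\Cup a)))$ 4. For every septuple $s=\langle n_{\rm B},n_{{\rm M}_0},\dots,n_{{\rm M}_5}\rangle$ the polynomial $P_s=(\cdots((B_{n_{\rm B}}\Cap M_{0,n_{{\rm M}_0}})\Cap M_{1,n_{{\rm M}_1}})\Cap\cdots)\Cap M_{5,n_{{\rm M}_5}}$, in which the factors with $n_{{\rm M}_i}=5$ are omitted, has septuple $s$. So each of the 746496 classes is represented by an explicit $\Cup,\Cap$-polynomial. 5. In particular, for each $n=1,\dots,96$ the polynomial $P_s$ with $s=\langle n_{\rm B},n_{\rm M},n_{\rm M},n_{\rm M},n_{\rm M},n_{\rm M},n_{\rm M}\rangle$ evaluates to $n_{a,b}$ for all $a,b$ in every OML,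 whichever pair $\cup_i,\cap_i$, $i=0,\dots,5$, is substituted for $\Cup,\Cap$. Moreover, a polynomial evaluates, in every OML and for all $i=0,\dots,5$, to one and the same Beran expression if and only if the six MO2 components of its septuple are equal. -/

import Mathlib

universe u

/-! ## Orthomodular lattices -/

/-- An orthomodular lattice (OML): a bounded lattice with an orthocomplementation `ᶜ` satisfying
the orthomodular law `a ≤ b → a ∪ (a' ∩ b) = b`. -/
class OrthomodularLattice (L : Type*) extends Lattice L, BoundedOrder L, Compl L where
  sup_compl_eq_top : ∀ a : L, a ⊔ aᶜ = ⊤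
  inf_compl_eq_bot : ∀ a : L, a ⊓ aᶜ = ⊥
  compl_involutive : ∀ a : L, aᶜᶜ = a
  compl_antitone : ∀ a b : L, a ≤ b → bᶜ ≤ aᶜ
  orthomodular : ∀ a b : L, a ≤ b → a ⊔ (aᶜ ⊓ b) = b

/-- The two-element Boolean algebra as an OML. -/
instance : OrthomodularLattice Bool where
  toLattice := DistribLattice.toLattice (α := Bool)
  toBoundedOrder := inferInstance
  sup_compl_eq_top := by decide
  inf_compl_eq_bot := by decide
  compl_involutive := by decide
  compl_antitone := by decide
  orthomodular := by decide

/-- The six-element OML `MO2`: bottom, top, and the four pairwise incomparable elements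
`x`, `y`, `y'` (written `yc`), `x'` (written `xc`). -/
inductive MO2 : Type
  | zero | x | y | yc | xc | one
  deriving DecidableEq

namespace MO2

instance : Fintype MO2 := ⟨{zero, x, y, yc, xc, one}, fun p => by cases p <;> decide⟩

def compl : MO2 → MO2
  | zero => one
  | x => xc
  | y => yc
  | yc => y
  | xc => x
  | one => zero

def sup (p q : MO2) : MO2 :=
  if p = q then p else if p = zero then q else if q = zero then p else one

def inf (p q : MO2) : MO2 :=
  if p = q then p else if p = one then q else if q = one then p else zero

instance : Compl MO2 := ⟨compl⟩

instance : Lattice MO2 :=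
  @Lattice.mk' MO2 ⟨sup⟩ ⟨inf⟩ (by decide) (by decide) (by decide) (by decide) (by decide) (by decide)

instance : BoundedOrder MO2 where
  top := one
  bot := zero
  le_top p := sup_eq_right.mp (by revert p; decide)
  bot_le p := sup_eq_right.mp (by revert p; decide)

instance : OrthomodularLattice MO2 where
  sup_compl_eq_top := by decide
  inf_compl_eq_bot := by decide
  compl_involutive := by decide
  compl_antitone p q h := by
    rw [← sup_eq_right] at h ⊢
    revert p q; decide
  orthomodular p q h := by
    rw [← sup_eq_right] at h
    revert p q; decide

end MO2

/-! ## Free orthomodular lattices -/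

/-- Terms in the language of ortholattices over the set `X` of variables. -/
inductive OMTerm (X : Type*) : Type _
  | var : X → OMTerm X
  | bot : OMTerm X
  | top : OMTerm X
  | compl : OMTerm X → OMTerm X
  | sup : OMTerm X → OMTerm X → OMTerm X
  | inf : OMTerm X → OMTerm X → OMTerm X

namespace OMTerm

/-- The least congruence on terms which contains the (equational) axioms of OMLs. -/
inductive Rel {X : Type*} : OMTerm X → OMTerm X → Prop
  | refl (s : OMTerm X) : Rel s s
  | symm {s t : OMTerm X} : Rel s t → Rel t s
  | trans {s t u : OMTerm X} : Rel s t → Rel t u → Rel s u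
  | congr_compl {s t : OMTerm X} : Rel s t → Rel s.compl t.compl
  | congr_sup {s t s' t' : OMTerm X} : Rel s t → Rel s' t' → Rel (s.sup s') (t.sup t')
  | congr_inf {s t s' t' : OMTerm X} : Rel s t → Rel s' t' → Rel (s.inf s') (t.inf t')
  | sup_comm (s t : OMTerm X) : Rel (s.sup t) (t.sup s)
  | inf_comm (s t : OMTerm X) : Rel (s.inf t) (t.inf s)
  | sup_assoc (s t u : OMTerm X) : Rel ((s.sup t).sup u) (s.sup (t.sup u))
  | inf_assoc (s t u : OMTerm X) : Rel ((s.inf t).inf u) (s.inf (t.inf u))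
  | sup_inf_self (s t : OMTerm X) : Rel (s.sup (s.inf t)) s
  | inf_sup_self (s t : OMTerm X) : Rel (s.inf (s.sup t)) s
  | sup_compl (s : OMTerm X) : Rel (s.sup s.compl) top
  | inf_compl (s : OMTerm X) : Rel (s.inf s.compl) bot
  | bot_sup (s : OMTerm X) : Rel (bot.sup s) s
  | sup_top (s : OMTerm X) : Rel (s.sup top) top
  | compl_compl (s : OMTerm X) : Rel s.compl.compl s
  | compl_sup (s t : OMTerm X) : Rel (s.sup t).compl (s.compl.inf t.compl)
  | orthomodular (s t : OMTerm X) : Rel (s.sup (s.compl.inf (s.sup t))) (s.sup t)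

instance setoid (X : Type*) : Setoid (OMTerm X) := ⟨Rel, Rel.refl, Rel.symm, Rel.trans⟩

/-- The value of a term in an OML under an assignment of the variables. -/
def eval {X L : Type*} [OrthomodularLattice L] (v : X → L) : OMTerm X → L
  | var i => v i
  | bot => ⊥
  | top => ⊤
  | compl s => (s.eval v)ᶜ
  | sup s t => s.eval v ⊔ t.eval v
  | inf s t => s.eval v ⊓ t.eval v

theorem Rel.eval_eq {X L : Type*} [OrthomodularLattice L] (v : X → L) {s t : OMTerm X}
    (h : Rel s t) : s.eval v = t.eval v := by
  induction h with
  | refl _ => rfl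
  | symm _ ih => exact ih.symm
  | trans _ _ ih₁ ih₂ => exact ih₁.trans ih₂
  | congr_compl _ ih => simp only [eval, ih]
  | congr_sup _ _ ih₁ ih₂ => simp only [eval, ih₁, ih₂]
  | congr_inf _ _ ih₁ ih₂ => simp only [eval, ih₁, ih₂]
  | sup_comm _ _ => exact _root_.sup_comm _ _
  | inf_comm _ _ => exact _root_.inf_comm _ _
  | sup_assoc _ _ _ => exact _root_.sup_assoc _ _ _
  | inf_assoc _ _ _ => exact _root_.inf_assoc _ _ _
  | sup_inf_self _ _ => exact _root_.sup_inf_self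
  | inf_sup_self _ _ => exact _root_.inf_sup_self
  | sup_compl _ => exact OrthomodularLattice.sup_compl_eq_top _
  | inf_compl _ => exact OrthomodularLattice.inf_compl_eq_bot _
  | bot_sup _ => exact bot_sup_eq _
  | sup_top _ => exact sup_top_eq _
  | compl_compl _ => exact OrthomodularLattice.compl_involutive _
  | compl_sup s t =>
    simp only [eval]
    apply le_antisymm
    · exact le_inf (OrthomodularLattice.compl_antitone _ _ le_sup_left)
        (OrthomodularLattice.compl_antitone _ _ le_sup_right)
    · rw [← OrthomodularLattice.compl_involutive ((s.eval v)ᶜ ⊓ (t.eval v)ᶜ)]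
      apply OrthomodularLattice.compl_antitone
      apply sup_le
      · conv_lhs => rw [← OrthomodularLattice.compl_involutive (s.eval v)]
        exact OrthomodularLattice.compl_antitone _ _ inf_le_left
      · conv_lhs => rw [← OrthomodularLattice.compl_involutive (t.eval v)]
        exact OrthomodularLattice.compl_antitone _ _ inf_le_right
  | orthomodular _ _ => exact OrthomodularLattice.orthomodular _ _ le_sup_left

end OMTerm

/-- The free OML over the set `X` of generators. -/
def FreeOML (X : Type*) : Type _ := Quotient (OMTerm.setoid X)

namespace FreeOML

/-- The generators of the free OML. -/
def of {X : Type*} (i : X) : FreeOML X := Quotient.mk _ (OMTerm.var i)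

def sup {X : Type*} : FreeOML X → FreeOML X → FreeOML X :=
  Quotient.map₂ OMTerm.sup fun _ _ h _ _ h' => OMTerm.Rel.congr_sup h h'

def inf {X : Type*} : FreeOML X → FreeOML X → FreeOML X :=
  Quotient.map₂ OMTerm.inf fun _ _ h _ _ h' => OMTerm.Rel.congr_inf h h'

instance (X : Type*) : Compl (FreeOML X) :=
  ⟨Quotient.map OMTerm.compl fun _ _ h => OMTerm.Rel.congr_compl h⟩

instance (X : Type*) : Lattice (FreeOML X) :=
  @Lattice.mk' (FreeOML X) ⟨sup⟩ ⟨inf⟩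
    (by rintro ⟨s⟩ ⟨t⟩; exact Quotient.sound (OMTerm.Rel.sup_comm s t))
    (by rintro ⟨s⟩ ⟨t⟩ ⟨u⟩; exact Quotient.sound (OMTerm.Rel.sup_assoc s t u))
    (by rintro ⟨s⟩ ⟨t⟩; exact Quotient.sound (OMTerm.Rel.inf_comm s t))
    (by rintro ⟨s⟩ ⟨t⟩ ⟨u⟩; exact Quotient.sound (OMTerm.Rel.inf_assoc s t u))
    (by rintro ⟨s⟩ ⟨t⟩; exact Quotient.sound (OMTerm.Rel.sup_inf_self s t))
    (by rintro ⟨s⟩ ⟨t⟩; exact Quotient.sound (OMTerm.Rel.inf_sup_self s t))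

instance (X : Type*) : BoundedOrder (FreeOML X) where
  top := Quotient.mk _ OMTerm.top
  bot := Quotient.mk _ OMTerm.bot
  le_top p := sup_eq_right.mp (by
    induction p using Quotient.inductionOn with
    | h s => exact Quotient.sound (OMTerm.Rel.sup_top s))
  bot_le p := sup_eq_right.mp (by
    induction p using Quotient.inductionOn with
    | h s => exact Quotient.sound (OMTerm.Rel.bot_sup s))

instance (X : Type*) : OrthomodularLattice (FreeOML X) where
  sup_compl_eq_top := by rintro ⟨s⟩; exact Quotient.sound (OMTerm.Rel.sup_compl s)
  inf_compl_eq_bot := by rintro ⟨s⟩; exact Quotient.sound (OMTerm.Rel.inf_compl s)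
  compl_involutive := by rintro ⟨s⟩; exact Quotient.sound (OMTerm.Rel.compl_compl s)
  compl_antitone p q h := by
    have h₁ : (p ⊔ q)ᶜ = pᶜ ⊓ qᶜ := by
      induction p using Quotient.inductionOn with
      | h s =>
        induction q using Quotient.inductionOn with
        | h t => exact Quotient.sound (OMTerm.Rel.compl_sup s t)
    rw [sup_eq_right.mpr h] at h₁
    exact inf_eq_right.mp h₁.symm
  orthomodular p q h := by
    have h₁ : p ⊔ (pᶜ ⊓ (p ⊔ q)) = p ⊔ q := by
      induction p using Quotient.inductionOn with
      | h s =>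
        induction q using Quotient.inductionOn with
        | h t => exact Quotient.sound (OMTerm.Rel.orthomodular s t)
    rwa [sup_eq_right.mpr h] at h₁

/-- The homomorphism from the free OML which extends the assignment `v` of the generators. -/
def lift {X L : Type*} [OrthomodularLattice L] (v : X → L) : FreeOML X → L :=
  Quotient.lift (OMTerm.eval v) fun _ _ h => OMTerm.Rel.eval_eq v h

/-- `lift v` extends `v` and preserves all operations. -/
theorem lift_hom {X L : Type*} [OrthomodularLattice L] (v : X → L) :
    (∀ i, lift v (of i) = v i) ∧ lift v ⊥ = ⊥ ∧ lift v ⊤ = ⊤ ∧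
      (∀ p, lift v pᶜ = (lift v p)ᶜ) ∧ (∀ p q, lift v (p ⊔ q) = lift v p ⊔ lift v q) ∧
      ∀ p q, lift v (p ⊓ q) = lift v p ⊓ lift v q := by
  refine ⟨fun _ => rfl, rfl, rfl, ?_, ?_, ?_⟩
  · rintro ⟨s⟩; rfl
  · rintro ⟨s⟩ ⟨t⟩; rfl
  · rintro ⟨s⟩ ⟨t⟩; rfl

end FreeOML

/-! ## The free OML on two generators: Boolean part, MO2 part, Beran expressions -/

/-- The free OML `F(a,b)` on two generators. -/
abbrev FreeOML2 : Type := FreeOML (Fin 2)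

namespace FreeOML2

def genA : FreeOML2 := FreeOML.of 0

def genB : FreeOML2 := FreeOML.of 1

/-- The Boolean part of an element of `F(a,b)`: the Boolean function (truth table) of `a` and `b`
that it induces, i.e. its image in the free Boolean algebra on two generators. -/
def boolPart (z : FreeOML2) : Bool → Bool → Bool := fun s t => FreeOML.lift ![s, t] z

/-- The MO2 part of an element of `F(a,b)`: its image under the homomorphism to `MO2` which
maps `a` to `x` and `b` to `y`. -/
def mo2Part (z : FreeOML2) : MO2 := FreeOML.lift ![MO2.x, MO2.y] z

end FreeOML2

section Beran

variable {L : Type*} [OrthomodularLattice L]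

/-- The numbering, 0 to 15, of the Boolean functions of `a` and `b`, by an expression for each. -/
def boolExpr (n : Fin 16) (a b : L) : L :=
  ![⊥, a ⊓ b, a ⊓ bᶜ, aᶜ ⊓ b, aᶜ ⊓ bᶜ, a, b, (a ⊓ b) ⊔ (aᶜ ⊓ bᶜ),
    (a ⊓ bᶜ) ⊔ (aᶜ ⊓ b), bᶜ, aᶜ, a ⊔ b, a ⊔ bᶜ, aᶜ ⊔ b, aᶜ ⊔ bᶜ, ⊤] n

/-- The numbering, 0 to 5, of the elements of `MO2` generated by `a` and `b`. -/
def mo2Expr (n : Fin 6) (a b : L) : L := ![⊥, a, b, bᶜ, aᶜ, ⊤] n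

/-- The expression in `a` and `b` with Boolean part `nB` and MO2 part `nM`: the join of those of
the meets `a ∩ b`, `a ∩ b'`, `a' ∩ b`, `a' ∩ b'` that lie below the Boolean function number `nB`,
joined with the `nM`-th of `0, a, b, b', a', 1` cut down to the orthocomplement of the join of
all four meets. -/
def beranOfParts (nB : Fin 16) (nM : Fin 6) (a b : L) : L :=
  ((((if boolExpr nB true true then a ⊓ b else ⊥) ⊔
    (if boolExpr nB true false then a ⊓ bᶜ else ⊥)) ⊔
    (if boolExpr nB false true then aᶜ ⊓ b else ⊥)) ⊔
    (if boolExpr nB false false then aᶜ ⊓ bᶜ else ⊥)) ⊔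
  (mo2Expr nM a b ⊓ ((a ⊔ b) ⊓ (a ⊔ bᶜ) ⊓ (aᶜ ⊔ b) ⊓ (aᶜ ⊔ bᶜ)))

/-- The number, 0 to 15, of the Boolean part of the `n`-th Beran expression (`1 ≤ n ≤ 96`). -/
def beranBool (n : ℕ) : Fin 16 := Fin.ofNat 16 ((n - 1) % 16)

/-- The number, 0 to 5, of the MO2 part of the `n`-th Beran expression (`1 ≤ n ≤ 96`). -/
def beranMO2 (n : ℕ) : Fin 6 := Fin.ofNat 6 ((n - 1) / 16)

/-- The `n`-th Beran expression (`1 ≤ n ≤ 96`), evaluated at elements `a`, `b` of an OML. -/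
def beran (n : ℕ) (a b : L) : L := beranOfParts (beranBool n) (beranMO2 n) a b

end Beran

/-! ## Classical (`i = 0`) and quantum (`i = 1, …, 5`) operations -/

section Operations

variable {L : Type*} [OrthomodularLattice L]

/-- The implications `a →ᵢ b`. -/
def qimp : Fin 6 → L → L → L
  | 0, a, b => aᶜ ⊔ b
  | 1, a, b => aᶜ ⊔ (a ⊓ b)
  | 2, a, b => bᶜᶜ ⊔ (bᶜ ⊓ aᶜ)
  | 3, a, b => ((aᶜ ⊓ b) ⊔ (aᶜ ⊓ bᶜ)) ⊔ (a ⊓ (aᶜ ⊔ b))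
  | 4, a, b => ((bᶜᶜ ⊓ aᶜ) ⊔ (bᶜᶜ ⊓ aᶜᶜ)) ⊔ (bᶜ ⊓ (bᶜᶜ ⊔ aᶜ))
  | 5, a, b => ((a ⊓ b) ⊔ (aᶜ ⊓ b)) ⊔ (aᶜ ⊓ bᶜ)

/-- The disjunctions: `a ∪₀ b = a ∪ b`, and `a ∪ᵢ b = a' →ᵢ b` for `i = 1, …, 5`. -/
def qsup (i : Fin 6) (a b : L) : L := if i = 0 then a ⊔ b else qimp i aᶜ b

/-- The conjunctions: `a ∩₀ b = a ∩ b`, and `a ∩ᵢ b = (a →ᵢ b')'` for `i = 1, …, 5`. -/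
def qinf (i : Fin 6) (a b : L) : L := if i = 0 then a ⊓ b else (qimp i a bᶜ)ᶜ

end Operations

/-! ## Two-variable polynomials of the classical-quantum algebra -/

/-- Polynomials in the variables `a`, `b`, the constants `0`, `1`, the complement, and the two
operation symbols `⋓`, `⋒`. -/
inductive QAPoly : Type
  | a | b | zero | one
  | compl : QAPoly → QAPoly
  | cup : QAPoly → QAPoly → QAPoly
  | cap : QAPoly → QAPoly → QAPoly

infixl:65 " ⋓ " => QAPoly.cup
infixl:70 " ⋒ " => QAPoly.cap

/-- The parts of an equivalence class: the number of the Boolean part and, for each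
`i = 0, …, 5`, the number of the MO2 part. -/
abbrev Septuple : Type := Fin 16 × (Fin 6 → Fin 6)

namespace QAPoly

instance : Compl QAPoly := ⟨compl⟩

/-- The value of a polynomial in an OML when `∪ᵢ`, `∩ᵢ` are substituted for `⋓`, `⋒`. -/
def eval {L : Type*} [OrthomodularLattice L] (i : Fin 6) (u v : L) : QAPoly → L
  | a => u
  | b => v
  | zero => ⊥
  | one => ⊤
  | compl p => (p.eval i u v)ᶜ
  | cup p q => qsup i (p.eval i u v) (q.eval i u v)
  | cap p q => qinf i (p.eval i u v) (q.eval i u v)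

/-- Equivalence of polynomials: `p = q` holds in every OML (of the universe `u`), for all values
of the variables, whichever of the pairs `∪ᵢ`, `∩ᵢ`, `i = 0, …, 5`, is substituted for
`⋓`, `⋒`. -/
def equivalence : Setoid QAPoly where
  r p q := ∀ (L : Type u) [OrthomodularLattice L] (x y : L) (i : Fin 6),
    p.eval i x y = q.eval i x y
  iseqv := ⟨fun _ _ _ _ _ _ => rfl, fun h L _ x y i => (h L x y i).symm,
    fun h h' L _ x y i => (h L x y i).trans (h' L x y i)⟩

/-- The element of `F(a,b)` to which `p` evaluates for the index `i`. -/
def toFree (p : QAPoly) (i : Fin 6) : FreeOML2 := p.eval i FreeOML2.genA FreeOML2.genB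

/-- `p` has the septuple `⟨n_B, n_{M_0}, …, n_{M_5}⟩`: for each `i`, the value of `p` in `F(a,b)`
has Boolean part number `n_B` and MO2 part number `n_{M_i}`. -/
def HasSeptuple (p : QAPoly) (s : Septuple) : Prop :=
  ∀ i : Fin 6, (p.toFree i).boolPart = (fun x y => boolExpr s.1 x y) ∧
    (p.toFree i).mo2Part = mo2Expr (s.2 i) MO2.x MO2.y

/-- Representatives of the classes `⟨n,5,5,5,5,5,5⟩`, `n = 0, …, 15`. -/
def boolTable : Fin 16 → QAPoly :=
  ![((a ⋒ b) ⋒ (b ⋒ aᶜ)) ⋓ (((aᶜ ⋓ b) ⋒ (b ⋓ a)) ⋒ ((a ⋒ b)ᶜ ⋒ (bᶜ ⋓ a))),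
    (a ⋒ b) ⋓ (((aᶜ ⋓ b) ⋒ (b ⋓ a)) ⋒ ((b ⋓ a) ⋒ (a ⋓ bᶜ))),
    (a ⋒ bᶜ) ⋓ (((a ⋒ b)ᶜ ⋒ (b ⋓ a)) ⋒ ((bᶜ ⋓ a) ⋒ (a ⋓ b))),
    (b ⋒ aᶜ) ⋓ (((b ⋒ a)ᶜ ⋒ (a ⋓ b)) ⋒ ((aᶜ ⋓ b) ⋒ (b ⋓ a))),
    ((a ⋓ b) ⋒ (((aᶜ ⋒ b) ⋒ (b ⋓ a)) ⋓ ((b ⋒ a) ⋓ (a ⋒ bᶜ))))ᶜ,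
    a ⋓ ((a ⋒ b) ⋓ (aᶜ ⋒ ((b ⋓ a) ⋒ (a ⋓ bᶜ)))),
    b ⋓ ((a ⋒ b) ⋓ (aᶜ ⋒ ((b ⋓ a) ⋒ (a ⋓ bᶜ)))),
    (a ⋒ b) ⋓ ((a ⋓ b)ᶜ ⋓ ((a ⋓ bᶜ) ⋒ (aᶜ ⋓ b))),
    (a ⋒ bᶜ) ⋓ ((a ⋒ (b ⋒ a))ᶜ ⋒ ((b ⋓ a) ⋓ b)),
    bᶜ ⋓ ((a ⋓ b)ᶜ ⋓ (a ⋒ ((b ⋒ a)ᶜ ⋒ (a ⋓ b)))),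
    aᶜ ⋓ ((a ⋓ b)ᶜ ⋓ (((a ⋓ b) ⋒ (b ⋒ a)ᶜ) ⋒ b)),
    a ⋓ (b ⋓ (bᶜ ⋒ (a ⋓ (a ⋒ bᶜ)))),
    a ⋓ (bᶜ ⋓ (b ⋒ (a ⋓ (a ⋒ b)))),
    b ⋓ (aᶜ ⋓ (a ⋒ (b ⋓ (b ⋒ a)))),
    (a ⋒ (bᶜ ⋒ a)) ⋓ (a ⋒ (b ⋒ a))ᶜ,
    one]

/-- `mo2Table i n` represents the class with Boolean part `15`, `i`-th MO2 part `n` and all other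
MO2 parts `5`; here `n = 0, …, 4`. -/
def mo2Table : Fin 6 → Fin 5 → QAPoly :=
  ![![(a ⋒ b) ⋓ ((a ⋒ bᶜ) ⋓ (aᶜ ⋒ ((b ⋓ a)ᶜ ⋓ b))),
      a ⋓ ((aᶜ ⋒ b) ⋓ (b ⋓ a)ᶜ),
      b ⋓ ((bᶜ ⋒ a) ⋓ (a ⋓ b)ᶜ),
      bᶜ ⋓ ((b ⋒ a) ⋓ (aᶜ ⋒ b)),
      aᶜ ⋓ ((a ⋒ b) ⋓ (bᶜ ⋒ a))],
    ![(a ⋒ (aᶜ ⋓ b)) ⋓ ((a ⋓ (b ⋓ aᶜ)) ⋒ ((a ⋒ b)ᶜ ⋓ b)),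
      a ⋓ (a ⋓ ((b ⋓ a) ⋓ aᶜ)),
      b ⋓ (a ⋓ (b ⋒ (b ⋓ a))ᶜ),
      bᶜ ⋓ (a ⋓ ((b ⋒ a) ⋓ b)),
      aᶜ ⋓ (b ⋓ ((a ⋒ b) ⋓ a))],
    ![((a ⋓ b) ⋒ bᶜ) ⋓ ((a ⋓ (aᶜ ⋓ b)) ⋒ ((b ⋓ a) ⋓ bᶜ)),
      a ⋓ (b ⋓ (bᶜ ⋓ (b ⋓ a))),
      a ⋓ (aᶜ ⋓ ((a ⋓ b) ⋒ b)),
      a ⋓ (a ⋒ ((a ⋓ b) ⋒ b))ᶜ,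
      b ⋓ (b ⋒ ((b ⋓ a) ⋒ a))ᶜ],
    ![(a ⋒ (a ⋓ (b ⋓ a))) ⋓ (a ⋓ (a ⋒ (b ⋓ a)))ᶜ,
      a ⋓ (aᶜ ⋓ (b ⋓ a)),
      b ⋓ (bᶜ ⋓ (a ⋓ b)),
      b ⋓ (a ⋓ (a ⋓ b)ᶜ),
      a ⋓ (b ⋓ (b ⋓ a)ᶜ)],
    ![(a ⋒ ((a ⋓ b) ⋓ a)) ⋓ (a ⋓ ((a ⋓ b) ⋒ a))ᶜ,
      a ⋓ ((a ⋓ b) ⋓ aᶜ),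
      b ⋓ ((b ⋓ a) ⋓ bᶜ),
      a ⋓ ((a ⋓ b)ᶜ ⋓ b),
      b ⋓ ((b ⋓ a)ᶜ ⋓ a)],
    ![(a ⋓ b) ⋓ (a ⋒ b)ᶜ,
      a ⋓ (a ⋓ (b ⋓ (b ⋒ a)ᶜ)),
      b ⋓ (a ⋓ ((a ⋒ b)ᶜ ⋓ b)),
      bᶜ ⋓ (b ⋓ (a ⋓ (a ⋓ b))),
      aᶜ ⋓ (a ⋓ (b ⋓ (b ⋓ a)))]]

/-- One step of the construction: change the `i`-th MO2 part from `5` to `n` (do nothing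
if `n = 5`). -/
def step (p : QAPoly) (i n : Fin 6) : QAPoly :=
  if h : (n : ℕ) < 5 then p ⋒ mo2Table i ⟨n, h⟩ else p

/-- The explicit representative of a septuple: start with the table entry for the Boolean part,
then adjust the MO2 parts for `i = 0, 1, …, 5` in succession. -/
def construct (s : Septuple) : QAPoly :=
  (List.finRange 6).foldl (fun p i => p.step i (s.2 i)) (boolTable s.1)

end QAPoly

/-! In any OML, an element `z` generated by `a`, `b` is caught between two lower bounds. The finite
algebras `Bool` and `MO2` decide which of the four meets lie below `z` and which below `zᶜ`. They
also decide which of `0, a, b, b', a', 1`, cut down to `upperComm a b`, lies below `z`, and its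
complement, cut down likewise, lies below `zᶜ`. `HasParts` records this. It holds for generators and
constants and survives all operations, so it holds for every term (`hasParts_eval`); the only
substantial case is the join, through `ofMO2_sup_inf_le`. The bounds for `z` and for `zᶜ` together
join to `⊤`, and orthomodularity then forces `z` to equal its lower bound (`eq_of_le_of_le_compl`,
`HasParts.eq_beranOfParts`). Hence two-variable identities can be checked in `Bool` and at `x`, `y`
in `MO2`. For polynomials this reduces the tables to finite computations. In `Bool` the six
conjunctions are the ordinary meet, and in `MO2` the top is neutral for each of them. A factor with
Boolean part `⊤` and a single MO2 part other than `⊤` therefore changes exactly that component,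
which realizes every septuple (`construct_hasSeptuple`). -/

namespace OrthomodularLattice

variable {L : Type*} [OrthomodularLattice L]

/-! ### De Morgan laws and the squeeze principle. -/

theorem le_compl_comm {a b : L} (h : a ≤ bᶜ) : b ≤ aᶜ := by
  simpa only [compl_involutive] using compl_antitone _ _ h

theorem compl_sup (a b : L) : (a ⊔ b)ᶜ = aᶜ ⊓ bᶜ :=
  le_antisymm (le_inf (compl_antitone _ _ le_sup_left) (compl_antitone _ _ le_sup_right))
    (le_compl_comm (sup_le (le_compl_comm inf_le_left) (le_compl_comm inf_le_right)))

theorem compl_inf (a b : L) : (a ⊓ b)ᶜ = aᶜ ⊔ bᶜ := by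
  rw [← compl_involutive (aᶜ ⊔ bᶜ), compl_sup, compl_involutive, compl_involutive]

theorem compl_top : (⊤ : L)ᶜ = ⊥ := by
  simpa using inf_compl_eq_bot (⊤ : L)

/-- An element squeezed between `P` and `Qᶜ` equals `P` as soon as `P ⊔ Q = ⊤`. -/
theorem eq_of_le_of_le_compl {P Q z : L} (h : P ⊔ Q = ⊤) (hP : P ≤ z) (hQ : Q ≤ zᶜ) : P = z := by
  refine le_antisymm hP ?_
  rw [← orthomodular P z hP]
  refine sup_le le_rfl ?_
  calc Pᶜ ⊓ z ≤ Pᶜ ⊓ Qᶜ := inf_le_inf_left _ (le_compl_comm hQ)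
    _ = ⊥ := by rw [← compl_sup, h, compl_top]
    _ ≤ P := bot_le

/-! ### Lower and upper commutators. -/

/-- The join of the four meets of two elements and their complements. -/
def lowerComm (a b : L) : L := (((a ⊓ b) ⊔ (a ⊓ bᶜ)) ⊔ (aᶜ ⊓ b)) ⊔ (aᶜ ⊓ bᶜ)

/-- The meet of the four joins of two elements and their complements. -/
def upperComm (a b : L) : L := (a ⊔ b) ⊓ (a ⊔ bᶜ) ⊓ (aᶜ ⊔ b) ⊓ (aᶜ ⊔ bᶜ)

theorem compl_lowerComm (a b : L) : (lowerComm a b)ᶜ = upperComm a b := by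
  simp only [lowerComm, upperComm, compl_sup, compl_inf, compl_involutive]
  ac_rfl

theorem lowerComm_compl_left (a b : L) : lowerComm aᶜ b = lowerComm a b := by
  simp only [lowerComm, compl_involutive]; ac_rfl

theorem lowerComm_comm (a b : L) : lowerComm a b = lowerComm b a := by
  simp only [lowerComm, inf_comm b a, inf_comm bᶜ a, inf_comm b aᶜ, inf_comm bᶜ aᶜ]; ac_rfl

/-- By orthomodularity `a` is the join of `(a ⊓ b) ⊔ (a ⊓ bᶜ)` and its relative complement in `a`.
The latter lies below two of the four joins by De Morgan and below the other two because it lies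
below `a`. -/
theorem left_le_lowerComm_sup (a b : L) : a ≤ lowerComm a b ⊔ (a ⊓ upperComm a b) := by
  have h : (a ⊓ b) ⊔ (a ⊓ bᶜ) ≤ a := sup_le inf_le_left inf_le_left
  conv_lhs => rw [← orthomodular _ _ h]
  refine sup_le (le_sup_of_le_left (le_sup_of_le_left le_sup_left)) (le_sup_of_le_right ?_)
  refine le_inf inf_le_right ?_
  simp only [compl_sup, compl_inf, compl_involutive, upperComm]
  refine le_inf (le_inf (le_inf ?_ ?_) ?_) ?_
  · exact inf_le_right.trans le_sup_left
  · exact inf_le_right.trans le_sup_left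
  · exact inf_le_left.trans inf_le_right
  · exact inf_le_left.trans inf_le_left

/-! ### Images of MO2 below the upper commutator. -/

/-- The elements named by the elements of `MO2`. -/
def ofMO2 (a b : L) : MO2 → L
  | .zero => ⊥
  | .x => a
  | .y => b
  | .yc => bᶜ
  | .xc => aᶜ
  | .one => ⊤

/-- Both commutators are invariant under exchanging the two elements and under complementing one, so
the case of `a` covers all four middle elements. -/
theorem ofMO2_le_lowerComm_sup (a b : L) (m : MO2) :
    ofMO2 a b m ≤ lowerComm a b ⊔ (ofMO2 a b m ⊓ upperComm a b) := by
  cases m with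
  | zero => exact bot_le
  | x => exact left_le_lowerComm_sup a b
  | y =>
    rw [← compl_lowerComm, lowerComm_comm a b, compl_lowerComm]
    exact left_le_lowerComm_sup b a
  | yc =>
    rw [← compl_lowerComm, lowerComm_comm a b, ← lowerComm_compl_left b a, compl_lowerComm]
    exact left_le_lowerComm_sup bᶜ a
  | xc =>
    rw [← compl_lowerComm, ← lowerComm_compl_left a b, compl_lowerComm]
    exact left_le_lowerComm_sup aᶜ b
  | one => simp [ofMO2, ← compl_lowerComm, sup_compl_eq_top]

theorem sup_compl_eq_top_of_le {p d : L} (h : p ≤ d) : d ⊔ pᶜ = ⊤ := by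
  rw [eq_top_iff, ← sup_compl_eq_top p]
  exact sup_le_sup_right h _

/-- Unless one element is `⊤` or the two are complementary, their join is one of the four joins
forming `upperComm`, and its complement is one of the meets inside `lowerComm`. -/
theorem lowerComm_sup_ofMO2 (a b : L) (m n : MO2) (h : m ⊔ n = .one) :
    lowerComm a b ⊔ (ofMO2 a b m ⊔ ofMO2 a b n) = ⊤ := by
  have h₁ : lowerComm a b ⊔ (aᶜ ⊔ bᶜ) = ⊤ := by
    rw [← compl_inf]
    exact sup_compl_eq_top_of_le (le_sup_of_le_left (le_sup_of_le_left le_sup_left))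
  have h₂ : lowerComm a b ⊔ (aᶜ ⊔ b) = ⊤ := by
    rw [← compl_involutive (aᶜ ⊔ b), compl_sup, compl_involutive]
    exact sup_compl_eq_top_of_le (le_sup_of_le_left (le_sup_of_le_left le_sup_right))
  have h₃ : lowerComm a b ⊔ (a ⊔ bᶜ) = ⊤ := by
    rw [← compl_involutive (a ⊔ bᶜ), compl_sup, compl_involutive]
    exact sup_compl_eq_top_of_le (le_sup_of_le_left le_sup_right)
  have h₄ : lowerComm a b ⊔ (a ⊔ b) = ⊤ := by
    rw [← compl_involutive (a ⊔ b), compl_sup]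
    exact sup_compl_eq_top_of_le le_sup_right
  cases m <;> cases n <;> first | exact absurd h (by decide) | skip
  all_goals simp only [ofMO2, top_sup_eq, sup_top_eq, sup_compl_eq_top, sup_comm aᶜ a,
    sup_comm bᶜ b, sup_comm b a, sup_comm b aᶜ, sup_comm bᶜ a, sup_comm bᶜ aᶜ, h₁, h₂, h₃, h₄]

/-- Cutting down to `upperComm a b` preserves the joins of `MO2`. -/
theorem ofMO2_sup_inf_le (a b : L) (m n : MO2) :
    ofMO2 a b (m ⊔ n) ⊓ upperComm a b ≤
      (ofMO2 a b m ⊓ upperComm a b) ⊔ (ofMO2 a b n ⊓ upperComm a b) := by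
  have key : m ⊔ n = m ∨ m ⊔ n = n ∨ m ⊔ n = .one := by revert m n; decide
  -- Only the third case has content: two incomparable elements of `MO2` always join to `⊤`.
  rcases key with h | h | h
  · rw [h]; exact le_sup_left
  · rw [h]; exact le_sup_right
  · refine inf_le_right.trans (le_of_eq (Eq.symm ?_))
    -- The two cut-down elements exhaust `upperComm a b`, since together with its complement
    -- `lowerComm a b` they dominate both uncut elements and hence `⊤`.
    refine eq_of_le_of_le_compl (Q := lowerComm a b) ?_ (sup_le inf_le_right inf_le_right) ?_
    · rw [eq_top_iff, ← lowerComm_sup_ofMO2 a b m n h, sup_comm _ (lowerComm a b)]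
      refine sup_le le_sup_left (sup_le ?_ ?_)
      · exact (ofMO2_le_lowerComm_sup a b m).trans (sup_le_sup_left le_sup_left _)
      · exact (ofMO2_le_lowerComm_sup a b n).trans (sup_le_sup_left le_sup_right _)
    · rw [← compl_lowerComm, compl_involutive]

theorem ofMO2_mono (a b : L) {m n : MO2} (h : m ≤ n) : ofMO2 a b m ≤ ofMO2 a b n := by
  have key : m = n ∨ m = .zero ∨ n = .one := by
    rw [← sup_eq_right] at h
    revert m n; decide
  rcases key with rfl | rfl | rfl
  · exact le_rfl
  · exact bot_le
  · exact le_top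

/-! ### Boolean and MO2 parts relative to two elements of an arbitrary OML. -/

/-- The meet of `a` or `aᶜ` with `b` or `bᶜ` which is an atom of the Boolean part. -/
def atom (a b : L) (s t : Bool) : L := (if s then a else aᶜ) ⊓ (if t then b else bᶜ)

/-- `z` has Boolean part `f` and MO2 part `m` relative to `a` and `b`. -/
structure HasParts (a b z : L) (f : Bool → Bool → Bool) (m : MO2) : Prop where
  atom_le : ∀ s t, f s t = true → atom a b s t ≤ z
  atom_le_compl : ∀ s t, f s t = false → atom a b s t ≤ zᶜ
  inf_le : ofMO2 a b m ⊓ upperComm a b ≤ z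
  inf_le_compl : ofMO2 a b mᶜ ⊓ upperComm a b ≤ zᶜ

theorem HasParts.compl {a b z : L} {f : Bool → Bool → Bool} {m : MO2} (h : HasParts a b z f m) :
    HasParts a b zᶜ (fun s t => (f s t)ᶜ) mᶜ where
  atom_le s t hf := h.atom_le_compl s t (by revert hf; cases f s t <;> decide)
  atom_le_compl s t hf := by
    rw [compl_involutive]
    exact h.atom_le s t (by revert hf; cases f s t <;> decide)
  inf_le := h.inf_le_compl
  inf_le_compl := by
    rw [compl_involutive, compl_involutive]
    exact h.inf_le

/-- Bounds on the complement of a join follow from De Morgan and monotonicity; the lower bound on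
the join itself is where distributivity over `upperComm` is needed. -/
theorem HasParts.sup {a b z w : L} {f g : Bool → Bool → Bool} {m n : MO2}
    (h : HasParts a b z f m) (h' : HasParts a b w g n) :
    HasParts a b (z ⊔ w) (fun s t => f s t ⊔ g s t) (m ⊔ n) where
  atom_le s t hf := by
    rcases Bool.or_eq_true_iff.1 hf with hf | hf
    · exact (h.atom_le s t hf).trans le_sup_left
    · exact (h'.atom_le s t hf).trans le_sup_right
  atom_le_compl s t hf := by
    obtain ⟨h₁, h₂⟩ := Bool.or_eq_false_iff.1 hf
    rw [compl_sup]
    exact le_inf (h.atom_le_compl s t h₁) (h'.atom_le_compl s t h₂)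
  inf_le := (ofMO2_sup_inf_le a b m n).trans (sup_le_sup h.inf_le h'.inf_le)
  inf_le_compl := by
    rw [compl_sup z w]
    refine le_inf (le_trans (inf_le_inf_right _ (ofMO2_mono a b ?_)) h.inf_le_compl)
      (le_trans (inf_le_inf_right _ (ofMO2_mono a b ?_)) h'.inf_le_compl)
    · exact compl_antitone _ _ le_sup_left
    · exact compl_antitone _ _ le_sup_right

theorem HasParts.inf {a b z w : L} {f g : Bool → Bool → Bool} {m n : MO2}
    (h : HasParts a b z f m) (h' : HasParts a b w g n) :
    HasParts a b (z ⊓ w) (fun s t => f s t ⊓ g s t) (m ⊓ n) := by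
  simpa only [compl_sup, compl_involutive] using (h.compl.sup h'.compl).compl

theorem hasParts_top (a b : L) : HasParts a b ⊤ (fun _ _ => ⊤) ⊤ where
  atom_le _ _ _ := le_top
  atom_le_compl _ _ hf := absurd hf (by decide)
  inf_le := le_top
  inf_le_compl := inf_le_left.trans bot_le

theorem hasParts_bot (a b : L) : HasParts a b ⊥ (fun _ _ => ⊥) ⊥ := by
  simpa only [compl_top] using (hasParts_top a b).compl

theorem hasParts_left (a b : L) : HasParts a b a (fun s _ => s) .x where
  atom_le s t hs := by simp [atom, hs]
  atom_le_compl s t hs := by simp [atom, hs]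
  inf_le := inf_le_left
  inf_le_compl := inf_le_left

theorem hasParts_right (a b : L) : HasParts a b b (fun _ t => t) .y where
  atom_le s t hs := by simp [atom, hs]
  atom_le_compl s t hs := by simp [atom, hs]
  inf_le := inf_le_left
  inf_le_compl := inf_le_left

theorem hasParts_eval (a b : L) (t : OMTerm (Fin 2)) :
    HasParts a b (t.eval ![a, b]) (fun x y => t.eval ![x, y]) (t.eval ![MO2.x, MO2.y]) := by
  induction t with
  | var i =>
    fin_cases i
    · exact hasParts_left a b
    · exact hasParts_right a b
  | bot => exact hasParts_bot a b
  | top => exact hasParts_top a b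
  | compl _ ih => exact ih.compl
  | sup _ _ ih₁ ih₂ => exact ih₁.sup ih₂
  | inf _ _ ih₁ ih₂ => exact ih₁.inf ih₂

theorem ofMO2_mo2Expr (a b : L) (n : Fin 6) : ofMO2 a b (mo2Expr n MO2.x MO2.y) = mo2Expr n a b := by
  fin_cases n <;> rfl

/-- An element is determined by its Boolean part and its MO2 part. -/
theorem HasParts.eq_beranOfParts {a b z : L} {nB : Fin 16} {nM : Fin 6}
    (h : HasParts a b z (fun x y => boolExpr nB x y) (mo2Expr nM MO2.x MO2.y)) :
    z = beranOfParts nB nM a b := by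
  obtain ⟨h₁, h₂, h₃, h₄⟩ := h
  simp only [ofMO2_mo2Expr] at h₃
  set c := upperComm a b
  set m := ofMO2 a b (mo2Expr nM MO2.x MO2.y)ᶜ
  -- `Q` is the Beran-type expression for the complementary parts, a lower bound of `zᶜ`.
  let Q : L := ((((if boolExpr nB true true then ⊥ else a ⊓ b) ⊔
    (if boolExpr nB true false then ⊥ else a ⊓ bᶜ)) ⊔
    (if boolExpr nB false true then ⊥ else aᶜ ⊓ b)) ⊔
    (if boolExpr nB false false then ⊥ else aᶜ ⊓ bᶜ)) ⊔ (m ⊓ c)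
  have le_ite (β : Bool) (u v : L) (hu : β = true → u ≤ v) : (if β then u else ⊥) ≤ v := by
    cases β
    · exact bot_le
    · exact hu rfl
  have ite_le (β : Bool) (u v : L) (hu : β = false → u ≤ v) : (if β then ⊥ else u) ≤ v := by
    cases β
    · exact hu rfl
    · exact bot_le
  have le_sup_ite (β : Bool) (u v w : L) (hv : (if β then u else ⊥) ≤ v)
      (hw : (if β then ⊥ else u) ≤ w) : u ≤ v ⊔ w := by
    cases β
    · exact le_sup_of_le_right hw
    · exact le_sup_of_le_left hv
  refine (eq_of_le_of_le_compl (Q := Q) ?_ ?_ ?_).symm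
  -- Each of the four meets occurs in the Beran expression or in `Q`, so their join dominates
  -- `lowerComm`; the complementary MO2 parts supply `upperComm`.
  · have hl : lowerComm a b ≤ beranOfParts nB nM a b ⊔ Q := by
      refine sup_le (sup_le (sup_le ?_ ?_) ?_) ?_
      · exact le_sup_ite _ _ _ _
          (le_sup_of_le_left (le_sup_of_le_left (le_sup_of_le_left le_sup_left)))
          (le_sup_of_le_left (le_sup_of_le_left (le_sup_of_le_left le_sup_left)))
      · exact le_sup_ite _ _ _ _
          (le_sup_of_le_left (le_sup_of_le_left (le_sup_of_le_left le_sup_right)))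
          (le_sup_of_le_left (le_sup_of_le_left (le_sup_of_le_left le_sup_right)))
      · exact le_sup_ite _ _ _ _
          (le_sup_of_le_left (le_sup_of_le_left le_sup_right))
          (le_sup_of_le_left (le_sup_of_le_left le_sup_right))
      · exact le_sup_ite _ _ _ _ (le_sup_of_le_left le_sup_right)
          (le_sup_of_le_left le_sup_right)
    have hu : upperComm a b ≤ beranOfParts nB nM a b ⊔ Q := by
      have := ofMO2_sup_inf_le a b (mo2Expr nM MO2.x MO2.y) (mo2Expr nM MO2.x MO2.y)ᶜ
      rw [sup_compl_eq_top, ofMO2_mo2Expr] at this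
      exact ((le_inf le_top le_rfl).trans this).trans (sup_le_sup le_sup_right le_sup_right)
    rw [eq_top_iff, ← sup_compl_eq_top (lowerComm a b), compl_lowerComm]
    exact sup_le hl hu
  · refine sup_le (sup_le (sup_le (sup_le ?_ ?_) ?_) ?_) h₃
    · exact le_ite _ _ _ (h₁ true true)
    · exact le_ite _ _ _ (h₁ true false)
    · exact le_ite _ _ _ (h₁ false true)
    · exact le_ite _ _ _ (h₁ false false)
  · refine sup_le (sup_le (sup_le (sup_le ?_ ?_) ?_) ?_) h₄
    · exact ite_le _ _ _ (h₂ true true)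
    · exact ite_le _ _ _ (h₂ true false)
    · exact ite_le _ _ _ (h₂ false true)
    · exact ite_le _ _ _ (h₂ false false)

end OrthomodularLattice

open OrthomodularLattice

/-! ### Normal forms in the free OML on two generators. -/

namespace FreeOML2

theorem lift_eq_beranOfParts {L : Type*} [OrthomodularLattice L] (x y : L) {z : FreeOML2}
    {nB : Fin 16} {nM : Fin 6} (hB : z.boolPart = fun s t => boolExpr nB s t)
    (hM : z.mo2Part = mo2Expr nM MO2.x MO2.y) :
    FreeOML.lift ![x, y] z = beranOfParts nB nM x y := by
  apply HasParts.eq_beranOfParts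
  rw [← hB, ← hM]
  induction z using Quotient.inductionOn with
  | h t => exact hasParts_eval x y t

theorem lift_gen (z : FreeOML2) : FreeOML.lift ![genA, genB] z = z := by
  induction z using Quotient.inductionOn with
  | h t =>
    change t.eval ![genA, genB] = Quotient.mk _ t
    induction t with
    | var i => fin_cases i <;> rfl
    | bot => rfl
    | top => rfl
    | compl s ih => rw [OMTerm.eval, ih]; rfl
    | sup s t ih₁ ih₂ => rw [OMTerm.eval, ih₁, ih₂]; rfl
    | inf s t ih₁ ih₂ => rw [OMTerm.eval, ih₁, ih₂]; rfl

theorem eq_beranOfParts {z : FreeOML2} {nB : Fin 16} {nM : Fin 6}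
    (hB : z.boolPart = fun s t => boolExpr nB s t) (hM : z.mo2Part = mo2Expr nM MO2.x MO2.y) :
    z = beranOfParts nB nM genA genB :=
  (lift_gen z).symm.trans (lift_eq_beranOfParts genA genB hB hM)

end FreeOML2

theorem boolExpr_bool_bijective :
    Function.Bijective fun (n : Fin 16) (s t : Bool) => boolExpr n s t := by
  rw [Fintype.bijective_iff_injective_and_card]
  refine ⟨?_, by simp⟩
  intro m n h
  have h' : ∀ s t, boolExpr m s t = boolExpr n s t := fun s t => congrFun (congrFun h s) t
  clear h
  revert m n
  decide

theorem mo2Expr_bijective : Function.Bijective fun n : Fin 6 => mo2Expr n MO2.x MO2.y := by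
  constructor
  · intro m n h
    revert m n
    decide
  · intro m
    revert m
    decide

theorem FreeOML.lift_beranOfParts {X L : Type*} [OrthomodularLattice L] (v : X → L) (nB : Fin 16)
    (nM : Fin 6) (p q : FreeOML X) :
    lift v (beranOfParts nB nM p q) = beranOfParts nB nM (lift v p) (lift v q) := by
  obtain ⟨-, hbot, htop, hc, hs, hi⟩ := lift_hom v
  have hM : lift v (mo2Expr nM p q) = mo2Expr nM (lift v p) (lift v q) := by
    fin_cases nM <;> simp [mo2Expr, hbot, htop, hc]
  simp only [beranOfParts, hs, hi, hc, hM, apply_ite (lift v), hbot]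

/-- In `Bool` the four joins meet in `⊥`, so the MO2 summand vanishes. -/
theorem beranOfParts_bool (nB : Fin 16) (nM : Fin 6) (s t : Bool) :
    beranOfParts nB nM s t = boolExpr nB s t := by
  revert nB nM s t
  decide

/-- At `x`, `y` the four meets are `⊥` and the four joins are `⊤`, so only the MO2 summand survives.
-/
theorem beranOfParts_mo2 (nB : Fin 16) (nM : Fin 6) :
    beranOfParts nB nM MO2.x MO2.y = mo2Expr nM MO2.x MO2.y := by
  revert nB nM
  decide

namespace FreeOML2

theorem boolPart_beranOfParts (nB : Fin 16) (nM : Fin 6) :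
    (beranOfParts nB nM genA genB).boolPart = fun s t => boolExpr nB s t := by
  funext s t
  exact (FreeOML.lift_beranOfParts _ _ _ _ _).trans (beranOfParts_bool nB nM s t)

theorem mo2Part_beranOfParts (nB : Fin 16) (nM : Fin 6) :
    (beranOfParts nB nM genA genB).mo2Part = mo2Expr nM MO2.x MO2.y :=
  (FreeOML.lift_beranOfParts _ _ _ _ _).trans (beranOfParts_mo2 nB nM)

theorem exists_eq_beranOfParts (z : FreeOML2) :
    ∃ nB nM, z = beranOfParts nB nM genA genB ∧ z.boolPart = (fun s t => boolExpr nB s t) ∧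
      z.mo2Part = mo2Expr nM MO2.x MO2.y := by
  obtain ⟨nB, hB⟩ := boolExpr_bool_bijective.2 z.boolPart
  obtain ⟨nM, hM⟩ := mo2Expr_bijective.2 z.mo2Part
  exact ⟨nB, nM, eq_beranOfParts hB.symm hM.symm, hB.symm, hM.symm⟩

theorem parts_bijective :
    Function.Bijective (fun z : FreeOML2 => (z.boolPart, z.mo2Part)) := by
  constructor
  · intro z w h
    obtain ⟨nB, nM, hz, hB, hM⟩ := exists_eq_beranOfParts z
    obtain ⟨h₁, h₂⟩ := Prod.ext_iff.1 h
    rw [hz, ← eq_beranOfParts (h₁.symm.trans hB) (h₂.symm.trans hM)]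
  · rintro ⟨f, m⟩
    obtain ⟨nB, rfl⟩ := boolExpr_bool_bijective.2 f
    obtain ⟨nM, rfl⟩ := mo2Expr_bijective.2 m
    exact ⟨_, Prod.ext (boolPart_beranOfParts nB nM) (mo2Part_beranOfParts nB nM)⟩

theorem beranOfParts_inj {nB nB' : Fin 16} {nM nM' : Fin 6}
    (h : beranOfParts nB nM genA genB = beranOfParts nB' nM' genA genB) : nB = nB' ∧ nM = nM' := by
  constructor
  · apply boolExpr_bool_bijective.1
    change (fun s t => boolExpr nB s t) = fun s t => boolExpr nB' s t
    rw [← boolPart_beranOfParts nB nM, ← boolPart_beranOfParts nB' nM', h]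
  · apply mo2Expr_bijective.1
    change mo2Expr nM MO2.x MO2.y = mo2Expr nM' MO2.x MO2.y
    rw [← mo2Part_beranOfParts nB nM, ← mo2Part_beranOfParts nB' nM', h]

theorem card_eq : Nat.card FreeOML2 = 96 := by
  rw [Nat.card_congr (Equiv.ofBijective _ parts_bijective), Nat.card_eq_fintype_card,
    Fintype.card_prod]
  rfl

end FreeOML2

/-! ### The numbering of the Beran expressions. -/

theorem exists_beran_index (nB : Fin 16) (nM : Fin 6) :
    ∃ n ∈ Set.Icc 1 96, beranBool n = nB ∧ beranMO2 n = nM := by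
  -- Division of `n - 1` by 16 is inverted; the `+ 1` is there because the numbering starts at 1.
  refine ⟨16 * nM + nB + 1, ⟨by omega, by omega⟩, ?_, ?_⟩
  · ext
    simp only [beranBool, Fin.ofNat]
    omega
  · ext
    simp only [beranMO2, Fin.ofNat]
    omega

theorem beran_index_injOn {m n : ℕ} (hm : m ∈ Set.Icc 1 96) (hn : n ∈ Set.Icc 1 96)
    (hB : beranBool m = beranBool n) (hM : beranMO2 m = beranMO2 n) : m = n := by
  obtain ⟨hm₁, hm₂⟩ := hm
  obtain ⟨hn₁, hn₂⟩ := hn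
  simp only [beranBool, beranMO2, Fin.ofNat, Fin.mk.injEq] at hB hM
  omega

theorem beran_bijOn :
    Set.BijOn (fun n => beran n FreeOML2.genA FreeOML2.genB) (Set.Icc 1 96) Set.univ := by
  refine ⟨fun _ _ => Set.mem_univ _, ?_, ?_⟩
  · intro m hm n hn h
    obtain ⟨hB, hM⟩ := FreeOML2.beranOfParts_inj h
    exact beran_index_injOn hm hn hB hM
  · intro z _
    obtain ⟨nB, nM, hz, -⟩ := FreeOML2.exists_eq_beranOfParts z
    obtain ⟨n, hn, rfl, rfl⟩ := exists_beran_index nB nM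
    exact ⟨n, hn, hz.symm⟩

/-! ### The six pairs of operations under homomorphisms, in `Bool` and in `MO2`. -/

theorem FreeOML.lift_qsup {X L : Type*} [OrthomodularLattice L] (v : X → L) (i : Fin 6)
    (p q : FreeOML X) : lift v (qsup i p q) = qsup i (lift v p) (lift v q) := by
  obtain ⟨-, -, -, hc, hs, hi⟩ := lift_hom v
  fin_cases i <;> simp [qsup, qimp, hc, hs, hi]

theorem FreeOML.lift_qinf {X L : Type*} [OrthomodularLattice L] (v : X → L) (i : Fin 6)
    (p q : FreeOML X) : lift v (qinf i p q) = qinf i (lift v p) (lift v q) := by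
  obtain ⟨-, -, -, hc, hs, hi⟩ := lift_hom v
  fin_cases i <;> simp [qinf, qimp, hc, hs, hi]

theorem qsup_bool (i : Fin 6) (s t : Bool) : qsup i s t = s ⊔ t := by
  revert i s t; decide

theorem qinf_bool (i : Fin 6) (s t : Bool) : qinf i s t = s ⊓ t := by
  revert i s t; decide

theorem qinf_mo2_top (i : Fin 6) (m : MO2) : qinf i m ⊤ = m := by
  revert i m; decide

theorem qinf_top_mo2 (i : Fin 6) (m : MO2) : qinf i ⊤ m = m := by
  revert i m; decide

/-! ### Septuples and equivalence of polynomials. -/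

namespace QAPoly

theorem lift_eval {X L : Type*} [OrthomodularLattice L] (v : X → L) (i : Fin 6)
    (u w : FreeOML X) (p : QAPoly) :
    FreeOML.lift v (p.eval i u w) = p.eval i (FreeOML.lift v u) (FreeOML.lift v w) := by
  obtain ⟨-, hbot, htop, hc, -, -⟩ := FreeOML.lift_hom v
  induction p with
  | a => rfl
  | b => rfl
  | zero => exact hbot
  | one => exact htop
  | compl p ih => simp only [eval, hc, ih]
  | cup p q ih₁ ih₂ => simp only [eval, FreeOML.lift_qsup, ih₁, ih₂]
  | cap p q ih₁ ih₂ => simp only [eval, FreeOML.lift_qinf, ih₁, ih₂]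

theorem lift_toFree {L : Type*} [OrthomodularLattice L] (x y : L) (p : QAPoly) (i : Fin 6) :
    FreeOML.lift ![x, y] (p.toFree i) = p.eval i x y :=
  lift_eval _ _ _ _ _

/-- Moves the condition from the free OML to two finite algebras, where it can be decided by
evaluation. -/
theorem hasSeptuple_iff (p : QAPoly) (s : Septuple) : p.HasSeptuple s ↔ ∀ i,
    (∀ x y : Bool, p.eval i x y = boolExpr s.1 x y) ∧
      p.eval i MO2.x MO2.y = mo2Expr (s.2 i) MO2.x MO2.y := by
  refine forall_congr' fun i => and_congr ?_ ?_
  · rw [funext_iff]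
    refine forall_congr' fun x => ?_
    rw [funext_iff]
    refine forall_congr' fun y => ?_
    rw [FreeOML2.boolPart, lift_toFree]
  · rw [FreeOML2.mo2Part, lift_toFree]

/-- All six pairs of operations collapse to join and meet in `Bool`; this is why one Boolean part
serves every index. -/
theorem eval_bool (p : QAPoly) (i j : Fin 6) (s t : Bool) : p.eval i s t = p.eval j s t := by
  induction p with
  | compl p ih => simp only [eval, ih]
  | cup p q ih₁ ih₂ => simp only [eval, qsup_bool, ih₁, ih₂]
  | cap p q ih₁ ih₂ => simp only [eval, qinf_bool, ih₁, ih₂]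
  | _ => rfl

theorem HasSeptuple.eval_eq {p : QAPoly} {s : Septuple} (h : p.HasSeptuple s) {L : Type*}
    [OrthomodularLattice L] (x y : L) (i : Fin 6) :
    p.eval i x y = beranOfParts s.1 (s.2 i) x y := by
  rw [← lift_toFree, FreeOML2.lift_eq_beranOfParts x y (h i).1 (h i).2]

theorem exists_hasSeptuple (p : QAPoly) : ∃ s, p.HasSeptuple s := by
  obtain ⟨nB, hB⟩ := boolExpr_bool_bijective.2 fun x y => p.eval 0 x y
  choose nM hM using fun i => mo2Expr_bijective.2 (p.eval i MO2.x MO2.y)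
  refine ⟨(nB, nM), (hasSeptuple_iff _ _).2 fun i => ⟨fun x y => ?_, (hM i).symm⟩⟩
  rw [eval_bool p i 0]
  exact (congrFun (congrFun hB x) y).symm

theorem HasSeptuple.unique {p : QAPoly} {s t : Septuple} (hs : p.HasSeptuple s)
    (ht : p.HasSeptuple t) : s = t := by
  refine Prod.ext ?_ (funext fun i => ?_)
  · exact boolExpr_bool_bijective.1 ((hs 0).1.symm.trans (ht 0).1)
  · exact mo2Expr_bijective.1 ((hs i).2.symm.trans (ht i).2)

/-- An identity that holds in all OMLs of some universe holds in all OMLs of any universe. -/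
theorem eval_eq_of_forall {p : QAPoly} {i : Fin 6}
    (φ : ∀ (L : Type u) [OrthomodularLattice L], L → L → L)
    (h : ∀ (L : Type u) [OrthomodularLattice L] (x y : L), p.eval i x y = φ L x y)
    {M : Type*} [OrthomodularLattice M] (x y : M) :
    p.eval i x y = FreeOML.lift (fun j : ULift.{u} (Fin 2) => ![x, y] j.down)
      (φ _ (FreeOML.of ⟨0⟩) (FreeOML.of ⟨1⟩)) := by
  -- The free OML over `ULift.{u} (Fin 2)` lives in universe `u`, so `h` applies to its generators;
  -- a homomorphism then carries the identity to `M`.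
  rw [← h, lift_eval]
  rfl

theorem equivalence_iff {p q : QAPoly} {s t : Septuple} (hp : p.HasSeptuple s)
    (hq : q.HasSeptuple t) : equivalence.{u} p q ↔ s = t := by
  constructor
  · intro h
    refine hp.unique ((hasSeptuple_iff _ _).2 fun i => ?_)
    -- The hypothesis concerns universe `u`, whereas `Bool` and `MO2` live in `Type`.
    have key {M : Type} [OrthomodularLattice M] (x y : M) : p.eval i x y = q.eval i x y := by
      rw [eval_eq_of_forall.{u} (fun L _ x y => q.eval i x y) (fun L _ x y => h L x y i) x y,
        lift_eval]
      rfl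
    simp only [key]
    exact (hasSeptuple_iff _ _).1 hq i
  · rintro rfl L _ x y i
    rw [hp.eval_eq, hq.eval_eq]

/-! ### The tables and the stepwise construction. -/

theorem boolTable_hasSeptuple (n : Fin 16) : (boolTable n).HasSeptuple (n, fun _ => 5) := by
  rw [hasSeptuple_iff]
  revert n
  decide

theorem mo2Table_hasSeptuple (i : Fin 6) (n : Fin 5) : (mo2Table i n).HasSeptuple
    (15, Function.update (fun _ => 5) i n.castSucc) := by
  rw [hasSeptuple_iff]
  revert i n
  decide

theorem HasSeptuple.step {p : QAPoly} {s : Septuple} (h : p.HasSeptuple s) {i : Fin 6}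
    (hi : s.2 i = 5) (n : Fin 6) : (p.step i n).HasSeptuple (s.1, Function.update s.2 i n) := by
  unfold QAPoly.step
  split_ifs with hn
  · rw [hasSeptuple_iff] at h ⊢
    intro j
    obtain ⟨h₁, h₂⟩ := h j
    obtain ⟨h₃, h₄⟩ := (hasSeptuple_iff _ _).1 (mo2Table_hasSeptuple i ⟨n, hn⟩) j
    refine ⟨fun x y => ?_, ?_⟩
    · change qinf j (p.eval j x y) (eval j x y _) = _
      rw [qinf_bool, h₁, h₃]
      exact inf_top_eq _
    · change qinf j (p.eval j MO2.x MO2.y) (eval j MO2.x MO2.y _) = _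
      rw [h₂, h₄]
      -- At `i` the old MO2 part is `⊤`, elsewhere that of the table entry is; in both cases the
      -- other factor is returned.
      by_cases hj : j = i
      · subst hj
        simp only [hi, Function.update_self]
        exact qinf_top_mo2 _ _
      · simp only [Function.update_of_ne hj]
        exact qinf_mo2_top _ _
  · have : n = 5 := by ext; change (n : ℕ) = 5; omega
    rw [this, ← hi, Function.update_eq_self]
    exact h

/-- Stated for an arbitrary duplicate-free list so that induction applies: each index still to be
processed keeps its initial value 5. -/
theorem HasSeptuple.foldl_step (f : Fin 6 → Fin 6) (l : List (Fin 6)) (hl : l.Nodup) {p : QAPoly}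
    {s : Septuple} (h : p.HasSeptuple s) (hs : ∀ i ∈ l, s.2 i = 5) :
    (l.foldl (fun p i => p.step i (f i)) p).HasSeptuple
      (s.1, fun i => if i ∈ l then f i else s.2 i) := by
  induction l generalizing p s with
  | nil => simpa using h
  | cons i l ih =>
    obtain ⟨hi, hl⟩ := List.nodup_cons.1 hl
    have h' := ih hl (h.step (hs i List.mem_cons_self) (f i)) fun j hj => by
      have hne : j ≠ i := by rintro rfl; exact hi hj
      simpa [Function.update_of_ne hne] using hs j (List.mem_cons_of_mem _ hj)
    have hf : (fun j => if j ∈ i :: l then f j else s.2 j) =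
        fun j => if j ∈ l then f j else Function.update s.2 i (f i) j := by
      funext j
      by_cases hj : j = i
      · subst hj; simp
      · simp [hj]
    rw [hf]
    exact h'

theorem construct_hasSeptuple (s : Septuple) : (construct s).HasSeptuple s := by
  simpa [construct] using (boolTable_hasSeptuple s.1).foldl_step s.2 (List.finRange 6)
    (List.nodup_finRange 6) fun _ _ => rfl

/-! ### Counting the classes and recognizing Beran expressions. -/

theorem card_quotient : Nat.card (Quotient equivalence.{u}) = 2 ^ 4 * 6 ^ 6 := by
  choose σ hσ using exists_hasSeptuple
  have hb : Function.Bijective (Quotient.lift (s := equivalence.{u}) σ fun p q h =>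
      (equivalence_iff (hσ p) (hσ q)).1 h) := by
    constructor
    · rintro ⟨p⟩ ⟨q⟩ h
      exact Quotient.sound ((equivalence_iff (hσ p) (hσ q)).2 h)
    · intro s
      exact ⟨Quotient.mk _ (construct s), (hσ _).unique (construct_hasSeptuple s)⟩
  rw [Nat.card_congr (Equiv.ofBijective _ hb), Nat.card_eq_fintype_card]
  simp [Septuple]

theorem exists_forall_eval_eq_beran_iff {p : QAPoly} {s : Septuple} (hp : p.HasSeptuple s) :
    (∃ n ∈ Set.Icc 1 96, ∀ (L : Type u) [OrthomodularLattice L] (x y : L) (i : Fin 6),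
      p.eval i x y = beran n x y) ↔ ∀ i j : Fin 6, s.2 i = s.2 j := by
  constructor
  · rintro ⟨n, -, h⟩
    -- Evaluating the common expression at `x`, `y` in `MO2` reads off a part that does not depend
    -- on `i`.
    have key (i : Fin 6) : s.2 i = beranMO2 n := by
      apply mo2Expr_bijective.1
      change mo2Expr (s.2 i) MO2.x MO2.y = mo2Expr (beranMO2 n) MO2.x MO2.y
      rw [← ((hasSeptuple_iff _ _).1 hp i).2, eval_eq_of_forall.{u} (fun L _ x y => beran n x y)
        (fun L _ x y => h L x y i), ← beranOfParts_mo2 (beranBool n)]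
      exact FreeOML.lift_beranOfParts _ _ _ _ _
    intro i j
    rw [key, key]
  · intro h
    obtain ⟨n, hn, hB, hM⟩ := exists_beran_index s.1 (s.2 0)
    refine ⟨n, hn, fun L _ x y i => ?_⟩
    rw [hp.eval_eq, h i 0, ← hB, ← hM]
    rfl

end QAPoly

theorem mainTheorem6 :
    -- `F(a,b)` is separated into Boolean part and MO2 part; it has 96 elements, the 96 Beran
    -- expressions, and Boolean part and MO2 part of the `n`-th one are read off from `n`
    (Function.Bijective (fun z : FreeOML2 => (z.boolPart, z.mo2Part)) ∧
      Nat.card FreeOML2 = 96 ∧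
      Set.BijOn (fun n => beran n FreeOML2.genA FreeOML2.genB) (Set.Icc 1 96) Set.univ ∧
      ∀ n ∈ Set.Icc 1 96,
        (beran n FreeOML2.genA FreeOML2.genB).boolPart
            = (fun x y => boolExpr (beranBool n) x y) ∧
          (beran n FreeOML2.genA FreeOML2.genB).mo2Part
            = mo2Expr (beranMO2 n) MO2.x MO2.y) ∧
    -- the equivalence classes correspond to the septuples
    ((∀ p : QAPoly, ∃! s : Septuple, p.HasSeptuple s) ∧
      (∀ (p q : QAPoly) (s t : Septuple), p.HasSeptuple s → q.HasSeptuple t →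
        (QAPoly.equivalence.{u} p q ↔ s = t)) ∧
      Nat.card (Quotient QAPoly.equivalence.{u}) = 2 ^ 4 * 6 ^ 6 ∧
      2 ^ 4 * 6 ^ 6 = 746496) ∧
    -- the two tables
    ((∀ n : Fin 16, (QAPoly.boolTable n).HasSeptuple (n, fun _ => 5)) ∧
      ∀ (i : Fin 6) (n : Fin 5), (QAPoly.mo2Table i n).HasSeptuple
        (15, Function.update (fun _ => 5) i n.castSucc)) ∧
    -- every septuple is represented by the polynomial constructed from the tables
    (∀ s : Septuple, (QAPoly.construct s).HasSeptuple s) ∧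
    -- every Beran expression is given, in every OML and for every classical or quantum operation
    -- substituted, by the polynomial constructed for its parts
    (∀ n ∈ Set.Icc 1 96, ∀ (L : Type u) [OrthomodularLattice L] (x y : L) (i : Fin 6),
      (QAPoly.construct (beranBool n, fun _ => beranMO2 n)).eval i x y = beran n x y) ∧
    -- a class corresponds to a Beran expression exactly if its six MO2 parts are equal
    (∀ (p : QAPoly) (s : Septuple), p.HasSeptuple s →
      ((∃ n ∈ Set.Icc 1 96, ∀ (L : Type u) [OrthomodularLattice L] (x y : L) (i : Fin 6),
        p.eval i x y = beran n x y) ↔ ∀ i j : Fin 6, s.2 i = s.2 j)) := by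
  exact ⟨⟨FreeOML2.parts_bijective, FreeOML2.card_eq, beran_bijOn, fun n _ =>
      ⟨FreeOML2.boolPart_beranOfParts _ _, FreeOML2.mo2Part_beranOfParts _ _⟩⟩,
    ⟨fun p => (QAPoly.exists_hasSeptuple p).imp fun s hs => ⟨hs, fun _ ht => ht.unique hs⟩,
      fun _ _ _ _ => QAPoly.equivalence_iff, QAPoly.card_quotient, by norm_num⟩,
    ⟨QAPoly.boolTable_hasSeptuple, QAPoly.mo2Table_hasSeptuple⟩,
    QAPoly.construct_hasSeptuple,
    fun n _ L _ x y i => (QAPoly.construct_hasSeptuple _).eval_eq x y i,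
    fun _ _ => QAPoly.exists_forall_eval_eq_beran_iff⟩
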